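/- Write $\mathbb D(0,r)=\{z\in\mathbb C:|z|<r\}$, $\mathbb D=\mathbb D(0,1)$, and $dA(z)=\frac{dx\,dy}{\pi}$. For $0<r<1$ and a complex polynomial $f$ put $$\Phi_f(z,r)=\left((1-|z|^2)|f(z)|-1_{\mathbb D(0,r)}(z)\right)^2,\qquad z\in\mathbb D,$$ $$\rho_{\mathbb H,r}(f)=\frac{\int_{\mathbb D(0,r)}\Phi_f(z,r)\frac{dA(z)}{1-|z|^2}}{\int_{\mathbb D(0,r)}\frac{dA(z)}{1-|z|^2}},\qquad \rho^*_{\mathbb H,r}(f)=\frac{\int_{\mathbb D}\Phi_f(z,r)\frac{dA(z)}{1-|z|^2}}{\int_{\mathbb D(0,r)}\frac{dA(z)}{1-|z|^2}}.$$ Let $\operatorname{Pol}(\mathbb C)$ be the space of all complex polynomials, let $\operatorname{Pol}_n(\mathbb C)$ be the space of those of degree at most $n-1$, and define the hyperbolic discrepancy densities $$\rho_{\mathbb H}=\liminf_{r\to1^-}\inf_{f\in\operatorname{Pol}(\mathbb C)}\rho_{\mathbb H,r}(f),\qquad \rho^*_{\mathbb H}=\liminf_{r\to1^-}\inf_{f\in\operatorname{Pol}(\mathbb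 C)}\rho^*_{\mathbb H,r}(f).$$ Then, with $n(r)=\left\lceil\frac{r^2}{1-r^2}\right\rceil$, $$\rho_{\mathbb H}=\liminf_{r\to1^-}\inf_{f\in\operatorname{Pol}_{n(r)}(\mathbb C)}\rho_{\mathbb H,r}(f)\qquad\text{and}\qquad \rho^*_{\mathbb H}=\liminf_{r\to1^-}\inf_{f\in\operatorname{Pol}_{n(r)}(\mathbb C)}\rho^*_{\mathbb H,r}(f).$$ -/

import Mathlib

open MeasureTheory Filter Topology Polynomial

noncomputable section

namespace ZeroPacking

/-- The normalized area measure `dA = dx dy / π` on the complex plane. -/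
def area : Measure ℂ := ENNReal.ofReal (1 / Real.pi) • volume

/-- The hyperbolic discrepancy function
`Φ_f(z, r) = ((1 - |z|²) |f(z)| - 1_{D(0,r)}(z))²`. -/
def discrepancy (f : ℂ → ℂ) (z : ℂ) (r : ℝ) : ℝ :=
  ((1 - ‖z‖ ^ 2) * ‖f z‖ - (Metric.ball (0 : ℂ) r).indicator (fun _ => (1 : ℝ)) z) ^ 2

/-- The normalizing factor `∫_{D(0,r)} dA(z) / (1 - |z|²)`. -/
def mass (r : ℝ) : ℝ :=
  ∫ z in Metric.ball (0 : ℂ) r, 1 / (1 - ‖z‖ ^ 2) ∂area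

/-- The functional `ρ_{H,r}(f)`: the average of `Φ_f(·, r)` over the disc `D(0,r)`. -/
def rho (r : ℝ) (f : ℂ[X]) : ℝ :=
  (∫ z in Metric.ball (0 : ℂ) r, discrepancy (fun w => f.eval w) z r / (1 - ‖z‖ ^ 2) ∂area) /
    mass r

/-- The tight functional `ρ*_{H,r}(f)`: here `Φ_f(·, r)` is integrated over the whole unit disc,
with the same normalization as in `ρ_{H,r}(f)`. -/
def rhoTight (r : ℝ) (f : ℂ[X]) : ℝ :=
  (∫ z in Metric.ball (0 : ℂ) 1, discrepancy (fun w => f.eval w) z r / (1 - ‖z‖ ^ 2) ∂area) /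
    mass r

/-- The hyperbolic discrepancy density `ρ_H`. For `0 < r < 1` the infimum lies in `[0, 1]`
(take `f = 0` for the upper bound), so that the real-valued infimum and lower limit are the
usual ones. -/
def rhoH : ℝ := liminf (fun r : ℝ => ⨅ f : ℂ[X], rho r f) (𝓝[<] 1)

/-- The tight hyperbolic discrepancy density `ρ*_H`. -/
def rhoHTight : ℝ := liminf (fun r : ℝ => ⨅ f : ℂ[X], rhoTight r f) (𝓝[<] 1)

/-- `n(r) = ⌈r² / (1 - r²)⌉`, a nonnegative integer for `0 < r < 1`. -/
def degBound (r : ℝ) : ℕ := ⌈r ^ 2 / (1 - r ^ 2)⌉₊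

end ZeroPacking

end

/-!
Write `L = ∫_{D(0,r)} dA / (1 - |z|²) = log (1 / (1 - r²))`. Up to the factor `L`, the density is
the squared distance in `L²(dA)` of `√(1 - |z|²) |f|` to `1_{D(0,r)} / √(1 - |z|²)`. Replacing this
indicator by that of `D(0,s)`, where `1 - s² = L (1 - r²)`, moves the target by `√(log L)`, which is
negligible against `√L`. Let `f` be truncated at degree `n ≥ c r² / (1 - r²)`. Outside `D(0,s)` the
new target vanishes, and since monomials are orthogonal on circles the truncation lowers the norm
there. Inside `D(0,s)` the discarded part has at most `L exp (c (1 - L))` times the squared norm of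
`f` over `D(0,r)`, because `(s² / r²) ^ n ≤ exp (c (1 - L))`; this factor tends to `0`.
-/

noncomputable section

namespace ZeroPacking

variable {f g : ℂ[X]} {r s R L c : ℝ} {n : ℕ}

theorem sq_lpNorm_two {α E : Type*} [MeasurableSpace α] [NormedAddCommGroup E] {μ : Measure α}
    {φ : α → E} (hφ : AEStronglyMeasurable φ μ) : lpNorm φ 2 μ ^ 2 = ∫ x, ‖φ x‖ ^ 2 ∂μ := by
  have h0 : 0 ≤ ∫ x, ‖φ x‖ ^ 2 ∂μ := integral_nonneg fun _ => sq_nonneg _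
  rw [lpNorm_eq_integral_norm_rpow_toReal two_ne_zero ENNReal.ofNat_ne_top hφ]
  simp only [ENNReal.toReal_ofNat, Real.rpow_ofNat]
  rw [← one_div, ← Real.sqrt_eq_rpow, Real.sq_sqrt h0]

theorem liminf_eq_liminf_of_tendsto_sub {ι : Type*} {F : Filter ι} [F.NeBot] {u v : ι → ℝ}
    (hu_ge : F.IsBoundedUnder (· ≥ ·) u) (hu_le : F.IsBoundedUnder (· ≤ ·) u)
    (h : Tendsto (v - u) F (𝓝 0)) : liminf u F = liminf v F := by
  have hvu : v = (v - u) + u := (sub_add_cancel v u).symm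
  have hlow := le_liminf_add h.isBoundedUnder_ge h.isBoundedUnder_le hu_ge
    hu_le.isCoboundedUnder_ge
  have hupp := liminf_add_le h.isBoundedUnder_ge h.isBoundedUnder_le hu_ge
    hu_le.isCoboundedUnder_ge
  rw [← hvu] at hlow hupp
  rw [h.liminf_eq, zero_add] at hlow
  rw [h.limsup_eq, zero_add] at hupp
  exact le_antisymm hlow hupp

section Polar

variable {E : Type*} [NormedAddCommGroup E] [NormedSpace ℝ E] {φ : ℂ → E}

theorem two_pi_smul_circleAverage_eq_integral_polarCoord (φ : ℂ → E) (t : ℝ) :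
    (2 * Real.pi) • Real.circleAverage φ 0 t
      = ∫ θ in Set.Ioo (-Real.pi) Real.pi, φ (Complex.polarCoord.symm (t, θ)) := by
  rw [Real.circleAverage_eq_integral_add (-Real.pi), smul_inv_smul₀ (by positivity),
    intervalIntegral.integral_comp_add_right (fun θ => φ (circleMap 0 t θ)), zero_add,
    show 2 * Real.pi + -Real.pi = Real.pi by ring,
    intervalIntegral.integral_of_le (by linarith [Real.pi_pos]), integral_Ioc_eq_integral_Ioo]
  simp [circleMap, Complex.exp_mul_I]

theorem continuous_complexPolarCoord_symm : Continuous Complex.polarCoord.symm :=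
  Complex.equivRealProdCLM.symm.continuous.comp continuous_polarCoord_symm

theorem setIntegral_ball_eq_setIntegral_polarCoord (φ : ℂ → E) (R : ℝ) :
    ∫ z in Metric.ball (0 : ℂ) R, φ z
      = ∫ p in Set.Ioo 0 R ×ˢ Set.Ioo (-Real.pi) Real.pi,
          p.1 • φ (Complex.polarCoord.symm p) := by
  have hsets : Set.Ioo 0 R ×ˢ Set.Ioo (-Real.pi) Real.pi
      = polarCoord.target ∩ Complex.polarCoord.symm ⁻¹' Metric.ball 0 R := by
    ext ⟨t, θ⟩
    simp only [polarCoord_target, Set.mem_prod, Set.mem_Ioo, Set.mem_inter_iff, Set.mem_Ioi,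
      Set.mem_preimage, mem_ball_zero_iff, Complex.norm_polarCoord_symm]
    constructor
    · rintro ⟨⟨h0, hR⟩, hθ⟩
      exact ⟨⟨h0, hθ⟩, by rwa [abs_of_pos h0]⟩
    · rintro ⟨⟨h0, hθ⟩, hR⟩
      exact ⟨⟨h0, by rwa [abs_of_pos h0] at hR⟩, hθ⟩
  have hmeas : MeasurableSet (Complex.polarCoord.symm ⁻¹' Metric.ball (0 : ℂ) R) :=
    measurableSet_ball.preimage continuous_complexPolarCoord_symm.measurable
  rw [← integral_indicator measurableSet_ball, ← Complex.integral_comp_polarCoord_symm, hsets,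
    ← setIntegral_indicator hmeas]
  refine integral_congr_ae (Eventually.of_forall fun p => ?_)
  simp only [← Set.indicator_comp_right, Set.indicator_smul, Function.comp_def]

theorem setIntegral_ball_area_eq_integral_circleAverage (hR : 0 ≤ R)
    (hφ : ContinuousOn φ (Metric.closedBall 0 R)) :
    ∫ z in Metric.ball (0 : ℂ) R, φ z ∂area
      = ∫ t in 0..R, (2 * t) • Real.circleAverage φ 0 t := by
  have hcont : ContinuousOn (fun p : ℝ × ℝ => p.1 • φ (Complex.polarCoord.symm p))
      (Set.Icc 0 R ×ˢ Set.Icc (-Real.pi) Real.pi) := by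
    refine continuousOn_fst.smul
      (hφ.comp continuous_complexPolarCoord_symm.continuousOn fun p hp => ?_)
    simpa [abs_of_nonneg hp.1.1] using hp.1.2
  have hint := (hcont.integrableOn_compact (μ := volume.prod volume)
    (isCompact_Icc.prod isCompact_Icc)).mono_set
      (Set.prod_mono Set.Ioo_subset_Icc_self Set.Ioo_subset_Icc_self)
  rw [area, Measure.restrict_smul, integral_smul_measure, ENNReal.toReal_ofReal (by positivity),
    setIntegral_ball_eq_setIntegral_polarCoord, Measure.volume_eq_prod, setIntegral_prod _ hint,
    ← integral_smul, intervalIntegral.integral_of_le hR, integral_Ioc_eq_integral_Ioo]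
  refine setIntegral_congr_fun measurableSet_Ioo fun t _ => ?_
  simp only [integral_smul, ← two_pi_smul_circleAverage_eq_integral_polarCoord, smul_smul]
  congr 1
  field_simp

end Polar

theorem circleAverage_sq_norm_eval (f : ℂ[X]) (t : ℝ) :
    Real.circleAverage (fun z => ‖f.eval z‖ ^ 2) 0 t
      = ∑ k ∈ f.support, ‖f.coeff k‖ ^ 2 * t ^ (2 * k) := by
  have hunit := (f.comp (C (t : ℂ) * X)).sum_sq_norm_coeff_eq_circleAverage
  simp only [eval_comp, eval_mul, eval_C, eval_X] at hunit
  rw [Real.circleAverage_eq_circleAverage_zero_one]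
  simp only [add_zero]
  rw [← hunit, Finset.sum_subset (s₂ := f.support)]
  · refine Finset.sum_congr rfl fun k _ => ?_
    rw [comp_C_mul_X_coeff, norm_mul, norm_pow, Complex.norm_real, mul_pow, pow_mul t,
      ← pow_mul, mul_comm k, pow_mul, Real.norm_eq_abs, sq_abs]
  · intro k hk
    rw [mem_support_iff, comp_C_mul_X_coeff] at hk
    exact mem_support_iff.2 (left_ne_zero_of_mul hk)
  · intro k _ hk
    simp [notMem_support_iff.1 hk]

theorem one_sub_sq_pos {t : ℝ} (ht0 : 0 ≤ t) (ht1 : t < 1) : 0 < 1 - t ^ 2 :=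
  sub_pos.2 (pow_lt_one₀ ht0 ht1 two_ne_zero)

theorem one_sub_sq_norm_pos {z : ℂ} (hR : R ≤ 1) (hz : z ∈ Metric.ball 0 R) :
    0 < 1 - ‖z‖ ^ 2 :=
  one_sub_sq_pos (norm_nonneg z) ((mem_ball_zero_iff.1 hz).trans_le hR)

theorem continuousOn_one_div_one_sub_sq_norm (hr : r < 1) :
    ContinuousOn (fun z : ℂ => 1 / (1 - ‖z‖ ^ 2)) (Metric.closedBall 0 r) := by
  refine continuousOn_const.div (by fun_prop) fun z hz => ?_
  exact (one_sub_sq_pos (norm_nonneg z) ((mem_closedBall_zero_iff.1 hz).trans_lt hr)).ne'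

theorem mass_eq_neg_log (hr0 : 0 ≤ r) (hr1 : r < 1) : mass r = -Real.log (1 - r ^ 2) := by
  have hpos : ∀ t ∈ Set.uIcc 0 r, 1 - t ^ 2 ≠ 0 := fun t ht => by
    rw [Set.uIcc_of_le hr0] at ht
    exact (one_sub_sq_pos ht.1 (ht.2.trans_lt hr1)).ne'
  have hradial (t : ℝ) :
      Real.circleAverage (fun z : ℂ => 1 / (1 - ‖z‖ ^ 2)) 0 t = 1 / (1 - t ^ 2) :=
    Real.circleAverage_const_on_circle fun z hz => by simp [mem_sphere_zero_iff_norm.1 hz]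
  rw [mass, setIntegral_ball_area_eq_integral_circleAverage hr0
    (continuousOn_one_div_one_sub_sq_norm hr1)]
  simp only [hradial, smul_eq_mul]
  rw [intervalIntegral.integral_eq_sub_of_hasDerivAt (f := fun t => -Real.log (1 - t ^ 2))]
  · simp
  · intro t ht
    have hderiv : HasDerivAt (fun t : ℝ => 1 - t ^ 2) (-(2 * t)) t := by
      simpa using (hasDerivAt_pow 2 t).const_sub 1
    exact (hderiv.log (hpos t ht)).neg.congr_deriv (by ring)
  · refine ContinuousOn.intervalIntegrable ?_
    exact ContinuousOn.mul (by fun_prop) (continuousOn_const.div (by fun_prop) hpos)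

instance : IsFiniteMeasureOnCompacts area :=
  IsFiniteMeasureOnCompacts.smul _ ENNReal.ofReal_ne_top

theorem integrableOn_ball_of_continuousOn {E : Type*} [NormedAddCommGroup E] {φ : ℂ → E}
    (hφ : ContinuousOn φ (Metric.closedBall 0 R)) : IntegrableOn φ (Metric.ball 0 R) area :=
  (hφ.integrableOn_compact (isCompact_closedBall 0 R)).mono_set Metric.ball_subset_closedBall

/-- The squared norm of a polynomial in `L²((1 - |z|²) dA)` over `D(0, R)`. -/
def energy (R : ℝ) (f : ℂ[X]) : ℝ :=
  ∫ z in Metric.ball (0 : ℂ) R, (1 - ‖z‖ ^ 2) * ‖f.eval z‖ ^ 2 ∂area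

/-- The energy of the monomial `X ^ k` over `D(0, R)`, that is, the integral of
`2 t (1 - t²) t ^ (2 k)` over `0 ≤ t ≤ R`, in closed form. -/
def monomialEnergy (k : ℕ) (R : ℝ) : ℝ :=
  R ^ (2 * (k + 1)) * (1 + (k + 1) * (1 - R ^ 2)) / ((k + 1) * (k + 2))

theorem integral_mul_one_sub_sq_mul_pow (k : ℕ) (R : ℝ) :
    ∫ t in 0..R, 2 * t * ((1 - t ^ 2) * t ^ (2 * k)) = monomialEnergy k R := by
  have hexpand (t : ℝ) : 2 * t * ((1 - t ^ 2) * t ^ (2 * k))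
      = 2 * t ^ (2 * k + 1) - 2 * t ^ (2 * k + 3) := by ring
  simp only [hexpand]
  rw [intervalIntegral.integral_sub (Continuous.intervalIntegrable (by fun_prop) _ _)
      (Continuous.intervalIntegrable (by fun_prop) _ _),
    intervalIntegral.integral_const_mul, intervalIntegral.integral_const_mul, integral_pow,
    integral_pow, monomialEnergy]
  push_cast
  field_simp
  ring

/-- Monomials are orthogonal for rotation-invariant weights. -/
theorem energy_eq_sum_of_support_subset (hR : 0 ≤ R) {S : Finset ℕ} (hS : f.support ⊆ S) :
    energy R f = ∑ k ∈ S, ‖f.coeff k‖ ^ 2 * monomialEnergy k R := by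
  have hmean (t : ℝ) : Real.circleAverage (fun z => (1 - ‖z‖ ^ 2) * ‖f.eval z‖ ^ 2) 0 t
      = ∑ k ∈ S, ‖f.coeff k‖ ^ 2 * ((1 - t ^ 2) * t ^ (2 * k)) := by
    have hcongr : Set.EqOn (fun z => (1 - ‖z‖ ^ 2) * ‖f.eval z‖ ^ 2)
        (fun z => (1 - t ^ 2) • ‖f.eval z‖ ^ 2) (Metric.sphere 0 |t|) := fun z hz => by
      simp [mem_sphere_zero_iff_norm.1 hz]
    rw [Real.circleAverage_congr_sphere hcongr, Real.circleAverage_fun_smul,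
      circleAverage_sq_norm_eval, smul_eq_mul, Finset.mul_sum,
      Finset.sum_subset hS fun k _ hk => by simp [notMem_support_iff.1 hk]]
    exact Finset.sum_congr rfl fun k _ => by ring
  rw [energy, setIntegral_ball_area_eq_integral_circleAverage hR (by fun_prop)]
  simp only [hmean, smul_eq_mul, Finset.mul_sum, mul_left_comm (2 * (_ : ℝ)) (‖_‖ ^ 2)]
  rw [intervalIntegral.integral_finsetSum fun k _ =>
    Continuous.intervalIntegrable (by fun_prop) _ _]
  simp only [intervalIntegral.integral_const_mul, integral_mul_one_sub_sq_mul_pow]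

theorem monomialEnergy_le_monomialEnergy (k : ℕ) (hs : 0 ≤ s) (hsR : s ≤ R) (hR : R ≤ 1) :
    monomialEnergy k s ≤ monomialEnergy k R := by
  rw [← integral_mul_one_sub_sq_mul_pow, ← integral_mul_one_sub_sq_mul_pow]
  refine intervalIntegral.integral_mono_interval le_rfl hs hsR ?_
    (Continuous.intervalIntegrable (by fun_prop) _ _)
  filter_upwards [ae_restrict_mem measurableSet_Ioc] with t ht
  have hweight : 0 ≤ 1 - t ^ 2 := sub_nonneg.2 (pow_le_one₀ ht.1.le (ht.2.trans hR))
  have ht0 : 0 < t := ht.1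
  simp only [Pi.zero_apply]
  positivity

theorem energy_nonneg (hR : R ≤ 1) (f : ℂ[X]) : 0 ≤ energy R f :=
  setIntegral_nonneg measurableSet_ball fun _ hz =>
    mul_nonneg (one_sub_sq_norm_pos hR hz).le (sq_nonneg _)

theorem energy_sub_energy_le (hs : 0 ≤ s) (hsR : s ≤ R) (hR : R ≤ 1)
    (hgf : ∀ k, ‖g.coeff k‖ ≤ ‖f.coeff k‖) :
    energy R g - energy s g ≤ energy R f - energy s f := by
  have hsupp : g.support ⊆ f.support := fun k hk => by
    rw [mem_support_iff, ← norm_pos_iff] at hk ⊢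
    exact hk.trans_le (hgf k)
  rw [energy_eq_sum_of_support_subset (hs.trans hsR) hsupp,
    energy_eq_sum_of_support_subset hs hsupp,
    energy_eq_sum_of_support_subset (hs.trans hsR) subset_rfl,
    energy_eq_sum_of_support_subset hs subset_rfl, ← Finset.sum_sub_distrib,
    ← Finset.sum_sub_distrib]
  simp only [← mul_sub]
  gcongr with k
  · exact sub_nonneg.2 (monomialEnergy_le_monomialEnergy k hs hsR hR)
  · exact hgf k

theorem energy_le_energy_of_norm_coeff_le (hR0 : 0 ≤ R) (hR : R ≤ 1)
    (hgf : ∀ k, ‖g.coeff k‖ ≤ ‖f.coeff k‖) : energy R g ≤ energy R f := by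
  simpa [energy] using energy_sub_energy_le le_rfl hR0 hR hgf

theorem energy_le_energy_of_le (hs : 0 ≤ s) (hsR : s ≤ R) (hR : R ≤ 1) (f : ℂ[X]) :
    energy s f ≤ energy R f := by
  simpa [energy] using energy_sub_energy_le (g := 0) hs hsR hR (f := f) (by simp)

theorem monomialEnergy_le_mul_monomialEnergy {k : ℕ} (hnk : n ≤ k) (hs : 0 ≤ s) (hsr : s ≤ r)
    (hr : 0 < r) (hr1 : r ≤ 1) (hL : 1 ≤ L) (hsL : 1 - s ^ 2 ≤ L * (1 - r ^ 2)) :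
    monomialEnergy k s ≤ L * (s ^ 2 / r ^ 2) ^ n * monomialEnergy k r := by
  have hpow : s ^ (2 * (k + 1)) ≤ (s ^ 2 / r ^ 2) ^ n * r ^ (2 * (k + 1)) := by
    have hratio : s ^ 2 / r ^ 2 ≤ 1 := (div_le_one (by positivity)).2 (by gcongr)
    calc s ^ (2 * (k + 1)) = (s ^ 2 / r ^ 2) ^ (k + 1) * r ^ (2 * (k + 1)) := by
          rw [pow_mul, pow_mul, ← mul_pow, div_mul_cancel₀ _ (by positivity)]
      _ ≤ (s ^ 2 / r ^ 2) ^ n * r ^ (2 * (k + 1)) := by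
          gcongr ?_ * _
          exact pow_le_pow_of_le_one (by positivity) hratio (by omega)
  have hweight : 1 + (k + 1) * (1 - s ^ 2) ≤ L * (1 + (k + 1) * (1 - r ^ 2)) := by
    nlinarith [mul_le_mul_of_nonneg_left hsL (by positivity : (0 : ℝ) ≤ k + 1)]
  have hs1 : 0 ≤ 1 - s ^ 2 := sub_nonneg.2 (pow_le_one₀ hs (hsr.trans hr1))
  rw [monomialEnergy, monomialEnergy, mul_div_assoc']
  gcongr ?_ / _
  calc s ^ (2 * (k + 1)) * (1 + (k + 1) * (1 - s ^ 2))
      ≤ (s ^ 2 / r ^ 2) ^ n * r ^ (2 * (k + 1)) * (L * (1 + (k + 1) * (1 - r ^ 2))) := by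
        gcongr
    _ = L * (s ^ 2 / r ^ 2) ^ n * (r ^ (2 * (k + 1)) * (1 + (k + 1) * (1 - r ^ 2))) := by ring

theorem energy_le_mul_energy_of_coeff_eq_zero (hs : 0 ≤ s) (hsr : s ≤ r) (hr : 0 < r)
    (hr1 : r ≤ 1) (hL : 1 ≤ L) (hsL : 1 - s ^ 2 ≤ L * (1 - r ^ 2))
    (hf : ∀ k < n, f.coeff k = 0) :
    energy s f ≤ L * (s ^ 2 / r ^ 2) ^ n * energy r f := by
  rw [energy_eq_sum_of_support_subset hs subset_rfl,
    energy_eq_sum_of_support_subset hr.le subset_rfl, Finset.mul_sum]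
  refine Finset.sum_le_sum fun k hk => ?_
  have hnk : n ≤ k := not_lt.1 fun hkn => mem_support_iff.1 hk (hf k hkn)
  rw [mul_left_comm]
  gcongr
  exact monomialEnergy_le_mul_monomialEnergy hnk hs hsr hr hr1 hL hsL

theorem ratio_pow_le_exp (hr : 0 < r) (hr1 : r < 1) (hL : 1 ≤ L)
    (hs : s ^ 2 = 1 - L * (1 - r ^ 2)) (hn : c * (r ^ 2 / (1 - r ^ 2)) ≤ n) :
    (s ^ 2 / r ^ 2) ^ n ≤ Real.exp (c * (1 - L)) := by
  have hw := one_sub_sq_pos hr.le hr1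
  have hratio : s ^ 2 / r ^ 2 ≤ Real.exp (-((L - 1) * (1 - r ^ 2) / r ^ 2)) := by
    refine le_trans (le_of_eq ?_) (Real.add_one_le_exp _)
    rw [hs]
    field_simp
    ring
  have hn' : c ≤ (1 - r ^ 2) / r ^ 2 * n := by
    rw [mul_div_assoc', div_le_iff₀ hw] at hn
    rw [div_mul_eq_mul_div, le_div_iff₀ (by positivity)]
    linarith
  calc (s ^ 2 / r ^ 2) ^ n ≤ Real.exp (-((L - 1) * (1 - r ^ 2) / r ^ 2)) ^ n := by gcongr
    _ = Real.exp (-((L - 1) * ((1 - r ^ 2) / r ^ 2 * n))) := by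
        rw [← Real.exp_nat_mul]
        congr 1
        ring
    _ ≤ Real.exp (c * (1 - L)) := Real.exp_le_exp.2 (by nlinarith)

/-- The normalized area measure on the disc `D(0, R)`. -/
abbrev discArea (R : ℝ) : Measure ℂ := area.restrict (Metric.ball 0 R)

/-- The function `√(1 - |z|²) |f(z)|`. The discrepancy `Φ_f(z, s) / (1 - |z|²)` is the squared
difference of this function and `target s`. -/
def profile (f : ℂ[X]) (z : ℂ) : ℝ := √(1 - ‖z‖ ^ 2) * ‖f.eval z‖

/-- The function `1_{D(0,s)}(z) / √(1 - |z|²)` which `profile f` has to approximate. -/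
def target (s : ℝ) : ℂ → ℝ := (Metric.ball 0 s).indicator fun z => 1 / √(1 - ‖z‖ ^ 2)

theorem sq_profile (f : ℂ[X]) {z : ℂ} (hz : 0 ≤ 1 - ‖z‖ ^ 2) :
    profile f z ^ 2 = (1 - ‖z‖ ^ 2) * ‖f.eval z‖ ^ 2 := by
  rw [profile, mul_pow, Real.sq_sqrt hz]

theorem sq_target (hs : s ≤ 1) :
    (fun z => target s z ^ 2) = (Metric.ball 0 s).indicator fun z => 1 / (1 - ‖z‖ ^ 2) := by
  ext z
  by_cases hz : z ∈ Metric.ball 0 s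
  · simp [target, hz, Real.sq_sqrt (one_sub_sq_norm_pos hs hz).le]
  · simp [target, hz]

theorem discrepancy_div_eq {z : ℂ} (hz : 0 < 1 - ‖z‖ ^ 2) :
    discrepancy (fun w => f.eval w) z s / (1 - ‖z‖ ^ 2) = (profile f z - target s z) ^ 2 := by
  have hsqrt : √(1 - ‖z‖ ^ 2) ≠ 0 := (Real.sqrt_pos.2 hz).ne'
  rw [discrepancy, profile, target]
  nth_rewrite 1 2 [← Real.sq_sqrt hz.le]
  rw [← div_pow]
  congr 1
  by_cases hzs : z ∈ Metric.ball 0 s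
  · simp only [Set.indicator_of_mem hzs]
    field_simp
  · simp only [Set.indicator_of_notMem hzs, sub_zero]
    field_simp

theorem continuous_profile (f : ℂ[X]) : Continuous (profile f) := by
  unfold profile
  fun_prop

theorem memLp_profile (f : ℂ[X]) (R : ℝ) : MemLp (profile f) 2 (discArea R) := by
  rw [memLp_two_iff_integrable_sq (continuous_profile f).aestronglyMeasurable]
  exact integrableOn_ball_of_continuousOn ((continuous_profile f).pow 2).continuousOn

theorem memLp_target (hs : s < 1) (R : ℝ) : MemLp (target s) 2 (discArea R) := by
  have hmeas : Measurable (target s) :=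
    Measurable.indicator (by fun_prop) measurableSet_ball
  rw [memLp_two_iff_integrable_sq hmeas.aestronglyMeasurable, sq_target hs.le]
  exact ((integrable_indicator_iff measurableSet_ball).2 (integrableOn_ball_of_continuousOn
    (continuousOn_one_div_one_sub_sq_norm hs))).mono_measure Measure.restrict_le_self

theorem integral_sq_profile (hR : R ≤ 1) (f : ℂ[X]) :
    ∫ z, profile f z ^ 2 ∂discArea R = energy R f :=
  setIntegral_congr_fun measurableSet_ball fun _ hz => sq_profile f (one_sub_sq_norm_pos hR hz).le

theorem integral_sq_target (hsR : s ≤ R) (hs : s ≤ 1) :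
    ∫ z, target s z ^ 2 ∂discArea R = mass s := by
  rw [sq_target hs, setIntegral_indicator measurableSet_ball,
    Set.inter_eq_right.2 (Metric.ball_subset_ball hsR), mass]

theorem sq_lpNorm_profile (hR : R ≤ 1) (f : ℂ[X]) :
    lpNorm (profile f) 2 (discArea R) ^ 2 = energy R f := by
  rw [sq_lpNorm_two (memLp_profile f R).1, ← integral_sq_profile hR]
  simp only [Real.norm_eq_abs, sq_abs]

theorem sq_lpNorm_target (hsR : s ≤ R) (hs : s < 1) :
    lpNorm (target s) 2 (discArea R) ^ 2 = mass s := by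
  rw [sq_lpNorm_two (memLp_target hs R).1, ← integral_sq_target hsR hs.le]
  simp only [Real.norm_eq_abs, sq_abs]

theorem sq_lpNorm_target_sub_target (hsr : s ≤ r) (hrR : r ≤ R) (hr : r < 1) :
    lpNorm (target r - target s) 2 (discArea R) ^ 2 = mass r - mass s := by
  have hs : s < 1 := hsr.trans_lt hr
  have hsq (z : ℂ) : ‖(target r - target s) z‖ ^ 2 = target r z ^ 2 - target s z ^ 2 := by
    rw [Real.norm_eq_abs, sq_abs, Pi.sub_apply]
    by_cases hz : z ∈ Metric.ball 0 s
    · simp [target, hz, Metric.ball_subset_ball hsr hz]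
    · simp [target, hz]
  rw [sq_lpNorm_two ((memLp_target hr R).sub (memLp_target hs R)).1]
  simp only [hsq]
  rw [integral_sub (memLp_target hr R).integrable_sq (memLp_target hs R).integrable_sq,
    integral_sq_target hrR hr.le, integral_sq_target (hsr.trans hrR) hs.le]

/-- The `L²(D(0, R))` distance of `profile f` to `target s`, that is, the square root of the
integral of `Φ_f(z, s) / (1 - |z|²)` over `D(0, R)`. -/
def discDist (R s : ℝ) (f : ℂ[X]) : ℝ := lpNorm (profile f - target s) 2 (discArea R)

theorem discDist_nonneg (R s : ℝ) (f : ℂ[X]) : 0 ≤ discDist R s f := lpNorm_nonneg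

theorem sq_discDist_eq_integral (hs : s < 1) (R : ℝ) (f : ℂ[X]) :
    discDist R s f ^ 2 = ∫ z, (profile f z - target s z) ^ 2 ∂discArea R := by
  rw [discDist, sq_lpNorm_two ((memLp_profile f R).sub (memLp_target hs R)).1]
  simp only [Real.norm_eq_abs, sq_abs, Pi.sub_apply]

theorem integral_discrepancy_div_eq_sq_discDist (hR : R ≤ 1) (hs : s < 1) (f : ℂ[X]) :
    ∫ z in Metric.ball (0 : ℂ) R, discrepancy (fun w => f.eval w) z s / (1 - ‖z‖ ^ 2) ∂area
      = discDist R s f ^ 2 := by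
  rw [sq_discDist_eq_integral hs]
  exact setIntegral_congr_fun measurableSet_ball fun z hz =>
    discrepancy_div_eq (one_sub_sq_norm_pos hR hz)

/-- Outside `D(0, s)` the target vanishes. -/
theorem sq_discDist_sub_energy_eq (hsR : s ≤ R) (hR : R ≤ 1) (hs : s < 1) (f : ℂ[X]) :
    discDist R s f ^ 2 - energy R f = discDist s s f ^ 2 - energy s f := by
  have hdiff {T : ℝ} (hT : T ≤ 1) : discDist T s f ^ 2 - energy T f
      = ∫ z in Metric.ball 0 T, ((profile f z - target s z) ^ 2 - profile f z ^ 2) ∂area := by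
    rw [sq_discDist_eq_integral hs, ← integral_sq_profile hT, ← integral_sub]
    · exact ((memLp_profile f T).sub (memLp_target hs T)).integrable_sq
    · exact (memLp_profile f T).integrable_sq
  rw [hdiff hR, hdiff hs.le]
  refine setIntegral_eq_of_subset_of_forall_sdiff_eq_zero measurableSet_ball
    (Metric.ball_subset_ball hsR) fun z hz => ?_
  simp [target, hz.2]

theorem abs_discDist_sub_discDist_le (hsr : s ≤ r) (hrR : r ≤ R) (hr : r < 1) (f : ℂ[X]) :
    |discDist R s f - discDist R r f| ≤ √(mass r - mass s) := by
  have hf := memLp_profile f R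
  have hts := memLp_target (hsr.trans_lt hr) R
  have htr := memLp_target hr R
  rw [← sq_lpNorm_target_sub_target hsr hrR hr, Real.sqrt_sq lpNorm_nonneg, abs_sub_le_iff,
    sub_le_iff_le_add', sub_le_iff_le_add']
  refine ⟨lpNorm_sub_le_lpNorm_sub_add_lpNorm_sub hf htr one_le_two, ?_⟩
  rw [lpNorm_sub_comm (target r)]
  exact lpNorm_sub_le_lpNorm_sub_add_lpNorm_sub hf hts one_le_two

theorem discDist_le_discDist_add_sqrt_energy_sub (hR : R ≤ 1) (f g : ℂ[X]) :
    discDist R s g ≤ discDist R s f + √(energy R (f - g)) := by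
  have hpointwise (z : ℂ) : ‖(profile g - profile f) z‖ ≤ profile (f - g) z := by
    rw [Pi.sub_apply, profile, profile, profile, ← mul_sub, Real.norm_eq_abs, abs_mul,
      abs_of_nonneg (Real.sqrt_nonneg _), eval_sub, norm_sub_rev]
    gcongr
    exact abs_norm_sub_norm_le _ _
  calc discDist R s g
      ≤ lpNorm (profile g - profile f) 2 (discArea R) + discDist R s f :=
        lpNorm_sub_le_lpNorm_sub_add_lpNorm_sub (memLp_profile g R) (memLp_profile f R) one_le_two
    _ ≤ lpNorm (profile (f - g)) 2 (discArea R) + discDist R s f := by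
        gcongr
        exact lpNorm_mono_real (memLp_profile _ R) hpointwise
    _ = discDist R s f + √(energy R (f - g)) := by
        rw [← sq_lpNorm_profile hR, Real.sqrt_sq lpNorm_nonneg, add_comm]

theorem sqrt_energy_le_discDist_add_sqrt_mass (hrR : r ≤ R) (hR : R ≤ 1) (hr : r < 1)
    (f : ℂ[X]) : √(energy R f) ≤ discDist R r f + √(mass r) := by
  rw [← sq_lpNorm_profile hR, ← sq_lpNorm_target hrR hr, Real.sqrt_sq lpNorm_nonneg,
    Real.sqrt_sq lpNorm_nonneg, add_comm]
  exact lpNorm_le_lpNorm_add_lpNorm_sub' (memLp_target hr R) one_le_two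

/-- If the coefficients of `g` are dominated by those of `f`, then passing from `f` to `g` does
not increase the energy of the annulus, so only the energy of `f - g` inside `D(0, s)` counts. -/
theorem discDist_le_discDist_add_sqrt_energy_sub_of_norm_coeff_le (hs0 : 0 ≤ s) (hs : s < 1)
    (hsR : s ≤ R) (hR : R ≤ 1) (hgf : ∀ k, ‖g.coeff k‖ ≤ ‖f.coeff k‖) :
    discDist R s g ≤ discDist R s f + √(energy s (f - g)) := by
  have hinner := discDist_le_discDist_add_sqrt_energy_sub (s := s) hs.le f g
  have hannulus := energy_sub_energy_le hs0 hsR hR hgf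
  have hf := sq_discDist_sub_energy_eq hsR hR hs f
  have hg := sq_discDist_sub_energy_eq hsR hR hs g
  have hgrow : discDist s s f ≤ discDist R s f := by
    refine le_of_sq_le_sq ?_ (discDist_nonneg R s f)
    linarith [energy_le_energy_of_le hs0 hsR hR f]
  refine le_of_sq_le_sq ?_ (add_nonneg (discDist_nonneg R s f) (Real.sqrt_nonneg _))
  have hinner_sq := pow_le_pow_left₀ (discDist_nonneg s s g) hinner 2
  have hcross := mul_le_mul_of_nonneg_right hgrow (Real.sqrt_nonneg (energy s (f - g)))
  linarith

theorem discDist_le_discDist_add_of_norm_coeff_le (hs0 : 0 ≤ s) (hsr : s ≤ r) (hr : r < 1)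
    (hrR : r ≤ R) (hR : R ≤ 1) (hgf : ∀ k, ‖g.coeff k‖ ≤ ‖f.coeff k‖) :
    discDist R r g ≤ discDist R r f + 2 * √(mass r - mass s) + √(energy s (f - g)) := by
  have hg := (abs_le.1 (abs_discDist_sub_discDist_le hsr hrR hr g)).1
  have hf := (abs_le.1 (abs_discDist_sub_discDist_le hsr hrR hr f)).2
  have hgf := discDist_le_discDist_add_sqrt_energy_sub_of_norm_coeff_le hs0 (hsr.trans_lt hr)
    (hsr.trans hrR) hR hgf
  linarith
theorem exists_radius_mass_sub_eq_log (hr0 : 0 ≤ r) (hr1 : r < 1) (hL : 1 ≤ mass r) :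
    ∃ s, 0 ≤ s ∧ s ≤ r ∧ s ^ 2 = 1 - mass r * (1 - r ^ 2) ∧
      mass r - mass s = Real.log (mass r) := by
  have hw := one_sub_sq_pos hr0 hr1
  have hexp : 1 - r ^ 2 = Real.exp (-mass r) := by
    rw [mass_eq_neg_log hr0 hr1, neg_neg, Real.exp_log hw]
  have hle : mass r * (1 - r ^ 2) ≤ 1 := by
    calc mass r * (1 - r ^ 2) ≤ Real.exp (mass r) * Real.exp (-mass r) := by
          rw [hexp]
          gcongr
          linarith [Real.add_one_le_exp (mass r)]
      _ = 1 := by rw [← Real.exp_add, add_neg_cancel, Real.exp_zero]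
  have hsq : √(1 - mass r * (1 - r ^ 2)) ^ 2 = 1 - mass r * (1 - r ^ 2) :=
    Real.sq_sqrt (sub_nonneg.2 hle)
  have hsr : √(1 - mass r * (1 - r ^ 2)) ≤ r :=
    Real.sqrt_le_iff.2 ⟨hr0, by nlinarith⟩
  refine ⟨_, Real.sqrt_nonneg _, hsr, hsq, ?_⟩
  rw [mass_eq_neg_log (Real.sqrt_nonneg _) (hsr.trans_lt hr1), hsq, sub_sub_cancel,
    Real.log_mul (by positivity) hw.ne', hexp, Real.log_exp]
  ring

theorem coeff_trunc_coe (n k : ℕ) (f : ℂ[X]) :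
    (PowerSeries.trunc n (f : PowerSeries ℂ)).coeff k = if k < n then f.coeff k else 0 := by
  rw [PowerSeries.coeff_trunc, coeff_coe]

theorem norm_coeff_trunc_le (n k : ℕ) (f : ℂ[X]) :
    ‖(PowerSeries.trunc n (f : PowerSeries ℂ)).coeff k‖ ≤ ‖f.coeff k‖ := by
  rw [coeff_trunc_coe]
  split_ifs <;> simp

theorem energy_sub_trunc_le (hs : 0 ≤ s) (hsr : s ≤ r) (hr : 0 < r) (hr1 : r < 1) (hL : 1 ≤ L)
    (hsL : s ^ 2 = 1 - L * (1 - r ^ 2)) (hn : c * (r ^ 2 / (1 - r ^ 2)) ≤ n) (f : ℂ[X]) :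
    energy s (f - PowerSeries.trunc n (f : PowerSeries ℂ))
      ≤ L * Real.exp (c * (1 - L)) * energy r f := by
  set tail := f - PowerSeries.trunc n (f : PowerSeries ℂ)
  have hcoeff (k : ℕ) : tail.coeff k = if k < n then 0 else f.coeff k := by
    rw [coeff_sub, coeff_trunc_coe]
    split_ifs <;> simp
  have htail : energy r tail ≤ energy r f :=
    energy_le_energy_of_norm_coeff_le hr.le hr1.le fun k => by
      rw [hcoeff]
      split_ifs <;> simp
  calc energy s tail ≤ L * (s ^ 2 / r ^ 2) ^ n * energy r tail :=
        energy_le_mul_energy_of_coeff_eq_zero hs hsr hr hr1.le hL (by linarith)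
          fun k hk => by rw [hcoeff, if_pos hk]
    _ ≤ L * Real.exp (c * (1 - L)) * energy r f := by
        gcongr
        · exact energy_nonneg hr1.le tail
        · exact ratio_pow_le_exp hr hr1 hL hsL hn

theorem discDist_trunc_le (hr : 0 < r) (hr1 : r < 1) (hrR : r ≤ R) (hR : R ≤ 1)
    (hL : 1 ≤ mass r) (hn : c * (r ^ 2 / (1 - r ^ 2)) ≤ n) (f : ℂ[X]) :
    discDist R r (PowerSeries.trunc n (f : PowerSeries ℂ))
      ≤ discDist R r f + 2 * √(Real.log (mass r))
        + √(mass r * Real.exp (c * (1 - mass r))) * (discDist R r f + √(mass r)) := by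
  obtain ⟨s, hs0, hsr, hsq, hlog⟩ := exists_radius_mass_sub_eq_log hr.le hr1 hL
  refine (discDist_le_discDist_add_of_norm_coeff_le hs0 hsr hr1 hrR hR
    (norm_coeff_trunc_le n · f)).trans ?_
  rw [hlog]
  gcongr
  calc √(energy s (f - PowerSeries.trunc n (f : PowerSeries ℂ)))
      ≤ √(mass r * Real.exp (c * (1 - mass r)) * energy R f) := by
        refine Real.sqrt_le_sqrt ((energy_sub_trunc_le hs0 hsr hr hr1 hL hsq hn f).trans ?_)
        gcongr
        exact energy_le_energy_of_le hr.le hrR hR f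
    _ = √(mass r * Real.exp (c * (1 - mass r))) * √(energy R f) := Real.sqrt_mul (by positivity) _
    _ ≤ √(mass r * Real.exp (c * (1 - mass r))) * (discDist R r f + √(mass r)) := by
        gcongr
        exact sqrt_energy_le_discDist_add_sqrt_mass hrR hR hr1 f

/-- The normalized integral of `Φ_f(·, r)` over `D(0, R)`. It is `rho r f` for `R = r` and
`rhoTight r f` for `R = 1`. -/
def discRho (R r : ℝ) (f : ℂ[X]) : ℝ :=
  (∫ z in Metric.ball (0 : ℂ) R, discrepancy (fun w => f.eval w) z r / (1 - ‖z‖ ^ 2) ∂area) /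
    mass r

theorem mass_nonneg (hr : r ≤ 1) : 0 ≤ mass r :=
  setIntegral_nonneg measurableSet_ball fun _ hz => (one_div_pos.2 (one_sub_sq_norm_pos hr hz)).le

theorem discRho_eq_sq (hR : R ≤ 1) (hr : r < 1) (f : ℂ[X]) :
    discRho R r f = (discDist R r f / √(mass r)) ^ 2 := by
  rw [discRho, integral_discrepancy_div_eq_sq_discDist hR hr, div_pow,
    Real.sq_sqrt (mass_nonneg hr.le)]

theorem discRho_nonneg (hR : R ≤ 1) (hr : r < 1) (f : ℂ[X]) : 0 ≤ discRho R r f := by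
  rw [discRho_eq_sq hR hr]
  positivity

theorem discRho_zero (hrR : r ≤ R) (hR : R ≤ 1) (hr : r < 1) (hmass : mass r ≠ 0) :
    discRho R r 0 = 1 := by
  have hzero : profile 0 - target r = -target r := by
    ext z
    simp [profile]
  rw [discRho_eq_sq hR hr, discDist, hzero, lpNorm_neg, div_pow, sq_lpNorm_target hrR hr,
    Real.sq_sqrt (mass_nonneg hr.le), div_self hmass]

/-- A bound for how much truncation at a degree `n ≥ c r² / (1 - r²)` can increase the square root
of a density `discRho R r f ≤ 1`, in terms of `L = mass r`. -/
def truncationError (c L : ℝ) : ℝ :=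
  2 * √(Real.log L / L) + 2 * √(L * Real.exp (c * (1 - L)))

theorem tendsto_truncationError (hc : 0 < c) : Tendsto (truncationError c) atTop (𝓝 0) := by
  have hlog : Tendsto (fun L : ℝ => Real.log L / L) atTop (𝓝 0) :=
    Real.isLittleO_log_id_atTop.tendsto_div_nhds_zero
  have hexp : Tendsto (fun L : ℝ => L * Real.exp (c * (1 - L))) atTop (𝓝 0) := by
    have h := (tendsto_rpow_mul_exp_neg_mul_atTop_nhds_zero 1 c hc).const_mul (Real.exp c)
    rw [mul_zero] at h
    refine h.congr fun L => ?_
    rw [Real.rpow_one, mul_left_comm, ← Real.exp_add]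
    congr 2
    ring
  unfold truncationError
  simpa using (hlog.sqrt.const_mul 2).add (hexp.sqrt.const_mul 2)

theorem truncationError_nonneg (c L : ℝ) : 0 ≤ truncationError c L := by
  unfold truncationError
  positivity

theorem discRho_trunc_le (hr : 0 < r) (hr1 : r < 1) (hrR : r ≤ R) (hR : R ≤ 1)
    (hL : 1 ≤ mass r) (hn : c * (r ^ 2 / (1 - r ^ 2)) ≤ n) (hf : discRho R r f ≤ 1) :
    discRho R r (PowerSeries.trunc n (f : PowerSeries ℂ))
      ≤ discRho R r f + (2 * truncationError c (mass r) + truncationError c (mass r) ^ 2) := by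
  set ε := truncationError c (mass r) with hε
  set a := discDist R r f / √(mass r) with ha
  have hmass : 0 < √(mass r) := Real.sqrt_pos.2 (zero_lt_one.trans_le hL)
  have ha0 : 0 ≤ a := div_nonneg (discDist_nonneg R r f) hmass.le
  have hε0 : 0 ≤ ε := truncationError_nonneg c _
  rw [discRho_eq_sq hR hr1, ← ha, sq_le_one_iff₀ ha0] at hf
  have hsqrt : discDist R r (PowerSeries.trunc n (f : PowerSeries ℂ)) / √(mass r) ≤ a + ε := by
    have htrunc := discDist_trunc_le hr hr1 hrR hR hL hn f
    rw [← div_mul_cancel₀ (discDist R r f) hmass.ne', ← ha] at htrunc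
    rw [div_le_iff₀ hmass, hε, truncationError, Real.sqrt_div (Real.log_nonneg hL)]
    calc _ ≤ _ := htrunc
      _ ≤ a * √(mass r) + 2 * √(Real.log (mass r))
          + √(mass r * Real.exp (c * (1 - mass r))) * (1 * √(mass r) + √(mass r)) := by gcongr
      _ = _ := by
        field_simp
        ring
  rw [discRho_eq_sq hR hr1, discRho_eq_sq hR hr1, ← ha]
  calc _ ≤ (a + ε) ^ 2 := pow_le_pow_left₀ (div_nonneg (discDist_nonneg R r _) hmass.le) hsqrt 2
    _ ≤ a ^ 2 + (2 * ε + ε ^ 2) := by nlinarith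

theorem bddBelow_range_discRho {ι : Type*} (hR : R ≤ 1) (hr : r < 1) (p : ι → ℂ[X]) :
    BddBelow (Set.range fun i => discRho R r (p i)) :=
  ⟨0, Set.forall_mem_range.2 fun i => discRho_nonneg hR hr (p i)⟩

theorem iInf_discRho_le_iInf_degreeLT (hR : R ≤ 1) (hr : r < 1) (n : ℕ) :
    ⨅ f : ℂ[X], discRho R r f ≤ ⨅ f : degreeLT ℂ n, discRho R r f :=
  le_ciInf fun f => ciInf_le (bddBelow_range_discRho hR hr id) (f : ℂ[X])

theorem iInf_degreeLT_discRho_le (hr : 0 < r) (hr1 : r < 1) (hrR : r ≤ R) (hR : R ≤ 1)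
    (hL : 1 ≤ mass r) (hn : c * (r ^ 2 / (1 - r ^ 2)) ≤ n) :
    ⨅ f : degreeLT ℂ n, discRho R r f ≤ (⨅ f : ℂ[X], discRho R r f)
      + (2 * truncationError c (mass r) + truncationError c (mass r) ^ 2) := by
  have hle (f : degreeLT ℂ n) : ⨅ f : degreeLT ℂ n, discRho R r f ≤ discRho R r f :=
    ciInf_le (bddBelow_range_discRho hR hr1 _) f
  have hε := truncationError_nonneg c (mass r)
  rw [← sub_le_iff_le_add]
  refine le_ciInf fun f => sub_le_iff_le_add.2 ?_
  rcases le_total (discRho R r f) 1 with hf | hf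
  · have hmem : PowerSeries.trunc n (f : PowerSeries ℂ) ∈ degreeLT ℂ n :=
      mem_degreeLT.2 (PowerSeries.degree_trunc_lt _ n)
    exact (hle ⟨_, hmem⟩).trans (discRho_trunc_le hr hr1 hrR hR hL hn hf)
  · calc ⨅ f : degreeLT ℂ n, discRho R r f ≤ discRho R r 0 := hle 0
      _ = 1 := discRho_zero hrR hR hr1 (zero_lt_one.trans_le hL).ne'
      _ ≤ _ := le_add_of_le_of_nonneg hf (by positivity)

theorem tendsto_mass : Tendsto mass (𝓝[<] 1) atTop := by
  have hunit : ∀ᶠ r : ℝ in 𝓝[<] 1, r ∈ Set.Ioo 0 1 := Ioo_mem_nhdsLT zero_lt_one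
  have hweight : Tendsto (fun r : ℝ => 1 - r ^ 2) (𝓝[<] 1) (𝓝[>] 0) := by
    refine tendsto_nhdsWithin_iff.2 ⟨?_, hunit.mono fun r hr => one_sub_sq_pos hr.1.le hr.2⟩
    exact Continuous.tendsto' (by fun_prop) 1 0 (by norm_num) |>.mono_left nhdsWithin_le_nhds
  refine (tendsto_neg_atBot_atTop.comp (Real.tendsto_log_nhdsGT_zero.comp hweight)).congr' ?_
  exact hunit.mono fun r hr => (mass_eq_neg_log hr.1.le hr.2).symm

end ZeroPacking

end

theorem corollary1p3_general {c : ℝ} {R : ℝ → ℝ} {n : ℝ → ℕ} (hc : 0 < c)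
    (hR : ∀ᶠ r in 𝓝[<] 1, R r ∈ Set.Icc r 1)
    (hn : ∀ᶠ r in 𝓝[<] 1, c * (r ^ 2 / (1 - r ^ 2)) ≤ n r) :
    liminf (fun r : ℝ => ⨅ f : ℂ[X], ZeroPacking.discRho (R r) r f) (𝓝[<] 1)
      = liminf (fun r : ℝ => ⨅ f : degreeLT ℂ (n r), ZeroPacking.discRho (R r) r f) (𝓝[<] 1) := by
  have hunit : ∀ᶠ r : ℝ in 𝓝[<] 1, r ∈ Set.Ioo 0 1 := Ioo_mem_nhdsLT zero_lt_one
  have hmass := ZeroPacking.tendsto_mass.eventually_ge_atTop 1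
  have hε := (ZeroPacking.tendsto_truncationError hc).comp ZeroPacking.tendsto_mass
  refine ZeroPacking.liminf_eq_liminf_of_tendsto_sub (isBoundedUnder_of_eventually_ge (a := 0) ?_)
    (isBoundedUnder_of_eventually_le (a := 1) ?_)
    (squeeze_zero' ?_ ?_ (by simpa using (hε.const_mul 2).add (hε.pow 2)))
  · filter_upwards [hunit, hR] with r hr hR
    exact Real.iInf_nonneg (ZeroPacking.discRho_nonneg hR.2 hr.2)
  · filter_upwards [hunit, hR, hmass] with r hr hR hL
    rw [← ZeroPacking.discRho_zero hR.1 hR.2 hr.2 (zero_lt_one.trans_le hL).ne']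
    exact ciInf_le (ZeroPacking.bddBelow_range_discRho hR.2 hr.2 id) 0
  · filter_upwards [hunit, hR] with r hr hR
    exact sub_nonneg.2 (ZeroPacking.iInf_discRho_le_iInf_degreeLT hR.2 hr.2 (n r))
  · filter_upwards [hunit, hR, hmass, hn] with r hr hR hL hn
    exact sub_le_iff_le_add'.2 (ZeroPacking.iInf_degreeLT_discRho_le hr.1 hr.2 hR.1 hR.2 hL hn)

/-- Here `degreeLT ℂ n` is the space of complex polynomials of degree at most `n - 1`. -/
theorem corollary1p3 :
    ZeroPacking.rhoH =
        liminf (fun r : ℝ => ⨅ f : degreeLT ℂ (ZeroPacking.degBound r),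
          ZeroPacking.rho r (f : ℂ[X])) (𝓝[<] 1) ∧
      ZeroPacking.rhoHTight =
        liminf (fun r : ℝ => ⨅ f : degreeLT ℂ (ZeroPacking.degBound r),
          ZeroPacking.rhoTight r (f : ℂ[X])) (𝓝[<] 1) :=
  have hlt : ∀ᶠ r : ℝ in 𝓝[<] 1, r ≤ 1 := eventually_nhdsWithin_of_forall fun _ hr => le_of_lt hr
  have hceil (r : ℝ) : 1 * (r ^ 2 / (1 - r ^ 2)) ≤ ZeroPacking.degBound r :=
    (one_mul _).trans_le (Nat.le_ceil _)
  ⟨corollary1p3_general (R := fun r => r) one_pos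
      (hlt.mono fun _ h => ⟨le_rfl, h⟩) (.of_forall hceil),
    corollary1p3_general (R := fun _ => 1) one_pos
      (hlt.mono fun _ h => ⟨h, le_rfl⟩) (.of_forall hceil)⟩
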